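/- Let $(R,\mathfrak m)$ be a Noetherian local ring of prime characteristic $p$ and dimension $d$. Assume that $R$ is equidimensional, i.e. $\dim R/P=\dim R$ for every minimal prime $P$ of $R$, and that $R$ is a homomorphic image of a Cohen-Macaulay ring. Let $R^{\circ}$ be the set of elements of $R$ lying outside all minimal primes, and for an ideal $J$ and $q=p^e$ let $J^{[q]}=(r^q \mid r\in J)$. The tight closure of $J$ is $$J^*=\{z\in R \mid \text{there is } c\in R^{\circ} \text{ with } cz^{q}\in J^{[q]} \text{ for all } q=p^e\gg 0\}.$$ An element $c\in R^{\circ}$ is a parameter test element if $cz^q\in J^{[q]}$ for every ideal $J$ generated by a system of parameters of $R$, every $z\in J^*$ and every $q=p^e$, $e\ge 0$. Let $x_1,\dots,x_d$ be a system of parameters of $R$ such that each $x_j$ is a parameter test element. Let $0\le i\le d$ and $I=(x_1,\dots,x_i)$, and define $$I^{\lim}=\bigcup_{s\ge 1}\bigl((x_1^s,\dots,x_i^s):(x_1\cdots x_i)^{s-1}\bigr),\qquad I^{germ}=\sum_{j=1}^{i}(x_1,\dots,\widehat{x_j},\dots,x_i)^*,$$ with $I^{\lim}=I^{germ}=0$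 for $i=0$. Then $$I^{germ}+I=I^{\lim},$$ and moreover $I^{germ}=I^{\lim}$ whenever $i\neq 1$. -/

import Mathlib

/-! Tight closure, limit closure and germ closure in Noetherian local rings of prime
characteristic, together with the notions of commutative algebra they are used with. -/

namespace TightClosure

universe u

section Dimension

/-- The depth of a local ring: the supremum of the lengths of the regular sequences contained in
the maximal ideal. -/
noncomputable def depth (R : Type u) [CommRing R] [IsLocalRing R] : ℕ∞ :=
  ⨆ rs : {rs : List R // RingTheory.Sequence.IsRegular R rs ∧
    ∀ r ∈ rs, r ∈ IsLocalRing.maximalIdeal R}, (rs.1.length : ℕ∞)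

/-- A Cohen-Macaulay local ring: a Noetherian local ring with `depth R = dim R`. -/
def IsCohenMacaulayLocalRing (R : Type u) [CommRing R] [IsLocalRing R] : Prop :=
  IsNoetherianRing R ∧ (depth R : WithBot ℕ∞) = ringKrullDim R

/-- A Cohen-Macaulay ring: a Noetherian ring all of whose localizations at maximal ideals are
Cohen-Macaulay local rings. -/
def IsCohenMacaulayRing (R : Type u) [CommRing R] : Prop :=
  IsNoetherianRing R ∧ ∀ (M : Ideal R) [M.IsMaximal],
    IsCohenMacaulayLocalRing (Localization.AtPrime M)

/-- A ring is equidimensional if `dim R/P = dim R` for every minimal prime `P`. -/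
def IsEquidimensional (R : Type u) [CommRing R] : Prop :=
  ∀ P ∈ minimalPrimes R, ringKrullDim (R ⧸ P) = ringKrullDim R

/-- `x₁, …, x_d` is a system of parameters of the local ring `R`: `d = dim R` and the elements
generate an ideal whose radical is the maximal ideal. -/
def IsSystemOfParameters {R : Type u} [CommRing R] [IsLocalRing R] {d : ℕ} (x : Fin d → R) :
    Prop :=
  (d : WithBot ℕ∞) = ringKrullDim R ∧
    (Ideal.span (Set.range x)).radical = IsLocalRing.maximalIdeal R

end Dimension

section Tight

/-- `R°`: the elements lying outside every minimal prime. -/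
def minimalPrimesCompl (R : Type u) [CommRing R] : Set R :=
  {c | ∀ P ∈ minimalPrimes R, c ∉ P}

/-- `I^{[q]}`, the ideal generated by the `q`-th powers of all the elements of `I`. -/
def bracketPower {R : Type u} [CommRing R] (I : Ideal R) (q : ℕ) : Ideal R :=
  Ideal.span ((fun r : R => r ^ q) '' (I : Set R))

theorem one_mem_minimalPrimesCompl (R : Type u) [CommRing R] :
    (1 : R) ∈ minimalPrimesCompl R :=
  fun P hP h => hP.1.1.ne_top ((Ideal.eq_top_iff_one P).2 h)

theorem mul_mem_minimalPrimesCompl {R : Type u} [CommRing R] {a b : R}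
    (ha : a ∈ minimalPrimesCompl R) (hb : b ∈ minimalPrimesCompl R) :
    a * b ∈ minimalPrimesCompl R := by
  intro P hP h
  rcases hP.1.1.mem_or_mem h with h | h
  · exact ha P hP h
  · exact hb P hP h

/-- The tight closure `I^*`: the elements `z` for which some `c ∈ R°` satisfies
`c z^q ∈ I^{[q]}` for all sufficiently large `q = p^e`. -/
def tightClosure {R : Type u} [CommRing R] (p : ℕ) [Fact p.Prime] [CharP R p]
    (I : Ideal R) : Ideal R where
  carrier := {z | ∃ c ∈ minimalPrimesCompl R, ∃ e₀ : ℕ, ∀ e ≥ e₀,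
    c * z ^ p ^ e ∈ bracketPower I (p ^ e)}
  zero_mem' := by
    refine ⟨1, one_mem_minimalPrimesCompl R, 0, fun e _ => ?_⟩
    have h : p ^ e ≠ 0 := pow_ne_zero _ (Fact.out : p.Prime).ne_zero
    simp [zero_pow h]
  add_mem' := by
    rintro a b ⟨c, hc, e₁, h₁⟩ ⟨c', hc', e₂, h₂⟩
    refine ⟨c * c', mul_mem_minimalPrimesCompl hc hc', max e₁ e₂, fun e he => ?_⟩
    have ha := h₁ e (le_trans (le_max_left _ _) he)
    have hb := h₂ e (le_trans (le_max_right _ _) he)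
    have key : c * c' * (a + b) ^ p ^ e
        = c' * (c * a ^ p ^ e) + c * (c' * b ^ p ^ e) := by
      rw [add_pow_char_pow]; ring
    rw [key]
    exact Ideal.add_mem _ (Ideal.mul_mem_left _ _ ha) (Ideal.mul_mem_left _ _ hb)
  smul_mem' := by
    rintro r a ⟨c, hc, e₁, h₁⟩
    refine ⟨c, hc, e₁, fun e he => ?_⟩
    have key : c * (r • a) ^ p ^ e = r ^ p ^ e * (c * a ^ p ^ e) := by
      rw [smul_eq_mul, mul_pow]; ring
    rw [key]
    exact Ideal.mul_mem_left _ _ (h₁ e he)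

/-- A parameter test element: an element `c ∈ R°` such that, for every ideal `I` generated by a
system of parameters and every `z ∈ I^*`, one has `c z^q ∈ I^{[q]}` for all `q = p^e`, `e ≥ 0`. -/
def IsParameterTestElement {R : Type u} [CommRing R] [IsLocalRing R]
    (p : ℕ) [Fact p.Prime] [CharP R p] (c : R) : Prop :=
  c ∈ minimalPrimesCompl R ∧
    ∀ (d : ℕ) (y : Fin d → R), IsSystemOfParameters y →
      ∀ z ∈ tightClosure p (Ideal.span (Set.range y)), ∀ e : ℕ,
        c * z ^ p ^ e ∈ bracketPower (Ideal.span (Set.range y)) (p ^ e)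

end Tight

section Closures

theorem limitClosure_aux {R : Type u} [CommRing R] {i : ℕ} (x : Fin i → R) (z : R)
    {s t : ℕ} (hs : 1 ≤ s) (hst : s ≤ t)
    (h : (∏ j, x j) ^ (s - 1) * z ∈ Ideal.span (Set.range fun j => x j ^ s)) :
    (∏ j, x j) ^ (t - 1) * z ∈ Ideal.span (Set.range fun j => x j ^ t) := by
  obtain ⟨k, rfl⟩ := Nat.exists_eq_add_of_le hst
  have key : (∏ j, x j) ^ (s + k - 1) * z
      = (∏ j, x j) ^ k * ((∏ j, x j) ^ (s - 1) * z) := by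
    rw [← mul_assoc, ← pow_add]
    congr 2
    omega
  rw [key]
  refine Submodule.span_induction (p := fun w _ => (∏ j, x j) ^ k * w ∈
    Ideal.span (Set.range fun j => x j ^ (s + k))) ?_ ?_ ?_ ?_ h
  · rintro _ ⟨j, rfl⟩
    obtain ⟨r, hr⟩ := Finset.dvd_prod_of_mem x (Finset.mem_univ j)
    have e : (∏ j, x j) ^ k * x j ^ s = r ^ k * x j ^ (s + k) := by
      rw [hr, mul_pow, pow_add]; ring
    change (∏ j, x j) ^ k * x j ^ s ∈ _
    rw [e]
    exact Ideal.mul_mem_left _ _ (Ideal.subset_span ⟨j, rfl⟩)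
  · simp
  · intro a b _ _ ha hb
    rw [mul_add]
    exact Ideal.add_mem _ ha hb
  · intro r a _ ha
    rw [smul_eq_mul, mul_left_comm]
    exact Ideal.mul_mem_left _ _ ha

/-- The limit closure of `(x₁, …, x_i)`: the union over `s ≥ 1` of the ideals
`(x₁^s, …, x_i^s) : (x₁ ⋯ x_i)^(s-1)`. For `i = 0` it is the zero ideal. -/
def limitClosure {R : Type u} [CommRing R] {i : ℕ} (x : Fin i → R) : Ideal R where
  carrier := {z | ∃ s : ℕ, 1 ≤ s ∧
    (∏ j, x j) ^ (s - 1) * z ∈ Ideal.span (Set.range fun j => x j ^ s)}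
  zero_mem' := ⟨1, le_rfl, by simp⟩
  add_mem' := by
    rintro a b ⟨s, hs, ha⟩ ⟨t, ht, hb⟩
    refine ⟨max s t, le_trans hs (le_max_left _ _), ?_⟩
    rw [mul_add]
    exact Ideal.add_mem _ (limitClosure_aux x a hs (le_max_left _ _) ha)
      (limitClosure_aux x b ht (le_max_right _ _) hb)
  smul_mem' := by
    rintro r a ⟨s, hs, ha⟩
    refine ⟨s, hs, ?_⟩
    rw [smul_eq_mul, mul_left_comm]
    exact Ideal.mul_mem_left _ _ ha

/-- The germ closure of `(x₁, …, x_i)`: the sum over `j` of the tight closures of the ideals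
generated by the `x_k` with `k ≠ j`. For `i = 0` the sum is empty, that is, the zero ideal. -/
def germClosure {R : Type u} [CommRing R] (p : ℕ) [Fact p.Prime] [CharP R p]
    {i : ℕ} (x : Fin i → R) : Ideal R :=
  ⨆ j : Fin i, tightClosure p (Ideal.span (x '' {k | k ≠ j}))

end Closures

end TightClosure

/-! The argument rests on two properties of the ideals generated by powers x_k^(n_k), k ∈ Λ,
packaged as `IsTestFamily`: colon capturing (for j ∉ Λ, the colon by x_j^(n_j) lies in the tight
closure), and the fact that each x_j multiplies the tight closure into the ideal. If z lies in the
tight closure of (x_k : k ≠ j), then x_j z ∈ (x_k : k ≠ j), and multiplying by the other x_k shows z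
∈ I^lim with s = 2. Conversely, `IsTestFamily.mem_germSum_update` cancels a factor x_k^(n_k-1) while
lowering the exponent n_k to 1; doing so for every k turns (x_1⋯x_i)^(s-1) z ∈ (x_1^s, …, x_i^s)
into z ∈ I^germ + I. For i ≠ 1 the summand I is already contained in I^germ.

Colon capturing needs a single c ∈ R° that kills these colons whatever the exponents, because
Frobenius multiplies the exponents by q. To get it, `exists_cover` writes R as a quotient of a
Noetherian ring B with dim B ≤ d in which lifts of the parameters, and all their powers, form weakly
regular sequences in any order. Equidimensionality makes minimal primes of R contract to minimal
primes of B. For each of them `exists_colonKills` finds a uniform annihilator outside it, by a prime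
filtration and an Artin-Rees bound; prime avoidance then yields c. -/

namespace TightClosure

open RingTheory.Sequence Pointwise

universe u v

/-! ### Uniform annihilation of colons in finite modules -/

/-- `c` multiplies the colon `(r₁, …, r_k) M : r` into `(r₁, …, r_k) M` for all weakly regular
sequences `r₁, …, r_k, r` of the ring with `k < n`. -/
def ColonKills (B : Type*) [CommRing B] (M : Type*) [AddCommGroup M] [Module B M]
    (n : ℕ) (c : B) : Prop :=
  ∀ (rs : List B) (r : B), rs.length < n → IsWeaklyRegular B (rs ++ [r]) → ∀ m : M,
    r • m ∈ (Ideal.ofList rs • ⊤ : Submodule B M) → c • m ∈ (Ideal.ofList rs • ⊤ : Submodule B M)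

section ColonKills

variable {B : Type*} [CommRing B] {M M₁ M₃ : Type*} [AddCommGroup M] [Module B M]
  [AddCommGroup M₁] [Module B M₁] [AddCommGroup M₃] [Module B M₃]

theorem map_smul_top_of_surjective (I : Ideal B) {g : M →ₗ[B] M₃} (hg : Function.Surjective g) :
    (I • ⊤ : Submodule B M).map g = I • ⊤ := by
  rw [Submodule.map_smul'', Submodule.map_top, LinearMap.range_eq_top.2 hg]

theorem ofList_append_singleton (rs : List B) (r : B) :
    Ideal.ofList (rs ++ [r]) = Ideal.ofList rs ⊔ Ideal.span {r} := by
  rw [Ideal.ofList_append, Ideal.ofList_singleton]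

theorem isWeaklyRegular_append_singleton_iff {rs : List B} {r : B} :
    IsWeaklyRegular B (rs ++ [r]) ↔
      IsWeaklyRegular B rs ∧ ∀ z, r * z ∈ Ideal.ofList rs → z ∈ Ideal.ofList rs := by
  rw [isWeaklyRegular_append_iff, isWeaklyRegular_singleton_iff]
  have e : (Ideal.ofList rs • ⊤ : Submodule B B) = Ideal.ofList rs := by simp
  rw [e, isSMulRegular_iff_right_eq_zero_of_smul]
  refine and_congr_right fun _ => ?_
  rw [(Submodule.Quotient.mk_surjective _).forall]
  refine forall_congr' fun z => ?_
  rw [← Submodule.Quotient.mk_smul, Submodule.Quotient.mk_eq_zero, Submodule.Quotient.mk_eq_zero,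
    smul_eq_mul]

/-- A uniform Artin-Rees statement along a weakly regular sequence. -/
theorem ColonKills.pow_smul_mem {n : ℕ} {c : B} (h : ColonKills B M₃ n c) {g : M →ₗ[B] M₃}
    (hg : Function.Surjective g) (rs : List B) (hn : rs.length ≤ n) (hrs : IsWeaklyRegular B rs)
    {m : M} (hm : g m = 0) (hm' : m ∈ (Ideal.ofList rs • ⊤ : Submodule B M)) :
    c ^ rs.length • m ∈ Ideal.ofList rs • LinearMap.ker g := by
  induction rs using List.reverseRecOn generalizing m with
  | nil => simpa using hm'
  | append_singleton rs r ih =>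
    have hrs' := ((isWeaklyRegular_append_iff B rs [r]).1 hrs).1
    rw [List.length_append, List.length_singleton] at hn ⊢
    rw [ofList_append_singleton, Submodule.sup_smul, Submodule.mem_sup] at hm'
    obtain ⟨a, ha, b', hb', rfl⟩ := hm'
    rw [Submodule.ideal_span_singleton_smul] at hb'
    obtain ⟨b, -, rfl⟩ := (Submodule.mem_smul_pointwise_iff_exists _ _ _).1 hb'
    -- From g (a + r b) = 0, the element r • g b lies in (rs) M₃. Hence c • g b lifts to some a' ∈
    -- (rs) M, and c b - a' lies in the kernel.
    have key : c • g b ∈ (Ideal.ofList rs • ⊤ : Submodule B M₃) := by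
      refine h rs r (by omega) hrs _ ?_
      have e : r • g b = -g a := by
        rw [← map_smul, eq_neg_iff_add_eq_zero, add_comm, ← map_add, hm]
      rw [e, ← map_smul_top_of_surjective _ hg]
      exact neg_mem (Submodule.mem_map_of_mem ha)
    rw [← map_smul_top_of_surjective _ hg] at key
    obtain ⟨a', ha', hga⟩ := key
    have hn' : g (c • b - a') = 0 := by rw [map_sub, hga, map_smul, sub_self]
    -- c m = (c a + r a') + r (c b - a'): the last term is in r · ker g, and the first is in ker g ∩
    -- (rs) M, so induction applies. Each element of the sequence costs one factor c.
    have h1 : c ^ rs.length • (c • a + r • a') ∈ Ideal.ofList rs • LinearMap.ker g := by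
      refine ih (by omega) hrs' ?_ (add_mem (Submodule.smul_mem _ _ ha)
        (Submodule.smul_mem _ _ ha'))
      have e : c • a + r • a' = c • (a + r • b) - r • (c • b - a') := by
        rw [smul_add, smul_sub, smul_comm r c b]; abel
      rw [e, map_sub, map_smul, hm, map_smul, hn']; simp
    have e : c ^ (rs.length + 1) • (a + r • b) =
        c ^ rs.length • (c • a + r • a') + c ^ rs.length • r • (c • b - a') := by
      rw [pow_succ, mul_smul, ← smul_add]
      congr 1
      rw [smul_add, smul_sub, smul_comm r c b]; abel
    rw [e, ofList_append_singleton, Submodule.sup_smul]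
    refine add_mem (Submodule.mem_sup_left h1) (Submodule.mem_sup_right ?_)
    refine Submodule.smul_mem _ _ (Submodule.smul_mem_smul (Ideal.mem_span_singleton_self r) hn')

theorem smul_mem_of_pow_le {N : Submodule B M} {c : B} {k n : ℕ} (hkn : k ≤ n) {m : M}
    (h : c ^ k • m ∈ N) : c ^ n • m ∈ N := by
  obtain ⟨l, rfl⟩ := Nat.exists_eq_add_of_le' hkn
  rw [pow_add, mul_smul]
  exact N.smul_mem _ h

theorem mem_smul_top_of_map_mem (I : Ideal B) {f : M₁ →ₗ[B] M} (hf : Function.Injective f)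
    {m : M₁} (h : f m ∈ I • LinearMap.range f) : m ∈ (I • ⊤ : Submodule B M₁) := by
  rw [← Submodule.map_top, ← Submodule.map_smul''] at h
  obtain ⟨m', hm', e⟩ := h
  rwa [← hf e]

/-- A diagram chase explains the constant. One c₃ moves m into the image of f modulo (rs) M, say to
f m₁; then f (r m₁) lies in ker g ∩ (rs) M, and c₃ ^ n carries it into (rs) f(M₁) by Artin-Rees;
finally c₁ acts on the colon in M₁. -/
theorem ColonKills.of_exact {n : ℕ} {c₁ c₃ : B} (h₁ : ColonKills B M₁ n c₁)
    (h₃ : ColonKills B M₃ n c₃) {f : M₁ →ₗ[B] M} {g : M →ₗ[B] M₃} (hf : Function.Injective f)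
    (hg : Function.Surjective g) (hfg : Function.Exact f g) :
    ColonKills B M n (c₁ * c₃ ^ n * c₃) := by
  intro rs r hn hrs m hm
  have hrs' := ((isWeaklyRegular_append_iff B rs [r]).1 hrs).1
  have key : c₃ • g m ∈ (Ideal.ofList rs • ⊤ : Submodule B M₃) := by
    refine h₃ rs r hn hrs _ ?_
    rw [← map_smul, ← map_smul_top_of_surjective _ hg]
    exact Submodule.mem_map_of_mem hm
  rw [← map_smul_top_of_surjective _ hg] at key
  obtain ⟨a, ha, hga⟩ := key
  obtain ⟨m₁, hm₁⟩ := (hfg (c₃ • m - a)).1 (by rw [map_sub, hga, map_smul, sub_self])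
  have h2 : f (r • m₁) ∈ (Ideal.ofList rs • ⊤ : Submodule B M) := by
    rw [map_smul, hm₁, smul_sub, smul_comm]
    exact sub_mem (Submodule.smul_mem _ _ hm) (Submodule.smul_mem _ _ ha)
  have h3 := h₃.pow_smul_mem hg rs hn.le hrs' (hfg.apply_apply_eq_zero _) h2
  rw [hfg.linearMap_ker_eq] at h3
  have h4 := smul_mem_of_pow_le hn.le h3
  rw [← map_smul] at h4
  have h5 := mem_smul_top_of_map_mem _ hf h4
  rw [smul_comm] at h5
  have h6 := Submodule.mem_map_of_mem (f := f) (h₁ rs r hn hrs _ h5)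
  rw [Submodule.map_smul''] at h6
  have h7 := Submodule.smul_mono le_rfl (le_top : _ ≤ (⊤ : Submodule B M)) h6
  have e : (c₁ * c₃ ^ n * c₃) • m = f (c₁ • c₃ ^ n • m₁) + (c₁ * c₃ ^ n) • a := by
    rw [map_smul, map_smul, hm₁]; module
  rw [e]
  exact add_mem h7 (Submodule.smul_mem _ _ ha)

/-- In B itself colons along weakly regular sequences are trivial, so f m already lies in (rs). Only
the passage from (rs) ∩ range f to (rs) · range f costs something, and Artin-Rees for the cokernel
needs colons by proper prefixes of rs only; hence the gain from n to n + 1. -/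
theorem ColonKills.succ_of_injective {n : ℕ} {c : B} (f : M₁ →ₗ[B] B)
    (hf : Function.Injective f) (h : ColonKills B (B ⧸ LinearMap.range f) n c) :
    ColonKills B M₁ (n + 1) (c ^ n) := by
  intro rs r hn hrs m hm
  have hrs' := ((isWeaklyRegular_append_iff B rs [r]).1 hrs).1
  have h0 := Submodule.mem_map_of_mem (f := f) hm
  rw [Submodule.map_smul''] at h0
  have h1 : r * f m ∈ Ideal.ofList rs := by
    have := Submodule.smul_mono le_rfl (le_top : _ ≤ (⊤ : Submodule B B)) h0
    simpa using this
  have h2 : f m ∈ (Ideal.ofList rs • ⊤ : Submodule B B) := by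
    simpa using (isWeaklyRegular_append_singleton_iff.1 hrs).2 _ h1
  have h3 := h.pow_smul_mem (Submodule.mkQ_surjective (LinearMap.range f)) rs (by omega) hrs'
    (m := f m)
    ((Submodule.Quotient.mk_eq_zero _).2 ⟨m, rfl⟩) h2
  rw [Submodule.ker_mkQ] at h3
  have h4 := smul_mem_of_pow_le (show rs.length ≤ n by omega) h3
  rw [← map_smul] at h4
  exact mem_smul_top_of_map_mem _ hf h4

theorem ColonKills.of_linearEquiv {n : ℕ} {c : B} (h : ColonKills B M n c) (e : M ≃ₗ[B] M₁) :
    ColonKills B M₁ n c := by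
  intro rs r hn hrs m hm
  have := h rs r hn hrs (e.symm m) (by
    rw [← map_smul, ← map_smul_top_of_surjective (g := e.symm.toLinearMap) _ e.symm.surjective]
    exact Submodule.mem_map_of_mem hm)
  have h2 := Submodule.mem_map_of_mem (f := e.toLinearMap) this
  rw [map_smul_top_of_surjective _ e.surjective] at h2
  simpa using h2

end ColonKills

/-- Uniform annihilation of colons: for a minimal prime `P` of a Noetherian ring and a finite
module, some element outside `P` annihilates all the colons along weakly regular sequences. -/
theorem exists_colonKills {B : Type u} [CommRing B] [IsNoetherianRing B] {P : Ideal B}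
    (hP : P ∈ minimalPrimes B) (n : ℕ) (M : Type u) [AddCommGroup M] [Module B M]
    (hM : Module.Finite B M) : ∃ c ∉ P, ColonKills B M n c := by
  have hPp : P.IsPrime := hP.1.1
  induction n generalizing M with
  | zero => exact ⟨1, fun h => hPp.ne_top ((Ideal.eq_top_iff_one P).2 h), fun rs r h => by omega⟩
  | succ n ih =>
    induction hM using IsNoetherianRing.induction_on_isQuotientEquivQuotientPrime B with
    | subsingleton N =>
      refine ⟨1, fun h => hPp.ne_top ((Ideal.eq_top_iff_one P).2 h), fun rs r _ _ m _ => ?_⟩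
      rw [Subsingleton.elim ((1 : B) • m) 0]
      exact zero_mem _
    | quotient N p e =>
      by_cases hp : p.1 = P
      -- A minimal prime of a Noetherian ring is associated, say the annihilator of b, so 1 ↦ b
      -- embeds B/P in B. The cokernel is handled by induction on n.
      · have hass : P ∈ associatedPrimes B B := by
          apply Module.associatedPrimes.minimalPrimes_annihilator_subset_associatedPrimes
          rw [Module.annihilator_eq_bot.2 inferInstance]
          exact hP
        rw [AssociatedPrimes.mem_iff, isAssociatedPrime_iff] at hass
        obtain ⟨-, b, hb⟩ := hass
        have hker : p.1 = LinearMap.ker (LinearMap.toSpanSingleton B B b) := by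
          rw [hp, hb]
          ext z
          simp [Submodule.mem_colon_singleton]
        let f : (B ⧸ p.1) →ₗ[B] B := p.1.liftQ (LinearMap.toSpanSingleton B B b) hker.le
        have hf : Function.Injective f := by
          rw [← LinearMap.ker_eq_bot]
          exact Submodule.ker_liftQ_eq_bot _ _ _ hker.ge
        obtain ⟨c, hc, h⟩ := ih (B ⧸ LinearMap.range f) inferInstance
        exact ⟨c ^ n, fun h => hc (hPp.mem_of_pow_mem _ h),
          (h.succ_of_injective f hf).of_linearEquiv e.symm⟩
      -- Minimality of P leaves an element of p outside P, and it annihilates B/p altogether.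
      · have : ¬ p.1 ≤ P := fun hle => hp (le_antisymm hle (hP.2 ⟨p.2, bot_le⟩ hle))
        obtain ⟨c, hc, hcP⟩ := SetLike.not_le_iff_exists.1 this
        refine ⟨c, hcP, fun rs r _ _ m _ => ?_⟩
        have : c • m = 0 := by
          apply e.injective
          rw [map_smul, map_zero]
          obtain ⟨z, hz⟩ := Submodule.Quotient.mk_surjective _ (e m)
          rw [← hz, ← Submodule.Quotient.mk_smul, Submodule.Quotient.mk_eq_zero]
          exact Ideal.mul_mem_right _ _ hc
        rw [this]
        exact zero_mem _
    | exact N₁ N₂ N₃ f g hf hg hfg h₁ h₃ =>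
      obtain ⟨c₁, hc₁, h₁⟩ := h₁
      obtain ⟨c₃, hc₃, h₃⟩ := h₃
      refine ⟨c₁ * c₃ ^ (n + 1) * c₃, fun h => ?_, h₁.of_exact h₃ hf hg hfg⟩
      rcases hPp.mem_or_mem h with h | h
      · rcases hPp.mem_or_mem h with h | h
        · exact hc₁ h
        · exact hc₃ (hPp.mem_of_pow_mem _ h)
      · exact hc₃ h

/-! ### Weakly regular sequences: powers, quotients, polynomial rings -/

/-- In a Noetherian local ring sequences in the maximal ideal may be permuted. Each entry is moved
to the end, where replacing it by a power is harmless, and moved back; `rest` absorbs the entries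
already treated. -/
theorem isWeaklyRegular_map_pow_append {A : Type*} [CommRing A] [IsLocalRing A]
    [IsNoetherianRing A] {ι : Type*} (a : ι → A) (k : ι → ℕ)
    (l : List ι) (hk : ∀ i ∈ l, 0 < k i) (ha : ∀ i ∈ l, a i ∈ IsLocalRing.maximalIdeal A)
    (rest : List A) (hrest : ∀ r ∈ rest, r ∈ IsLocalRing.maximalIdeal A)
    (h : IsWeaklyRegular A (l.map a ++ rest)) :
    IsWeaklyRegular A (l.map (fun i => a i ^ k i) ++ rest) := by
  have hpow (i) (hi : i ∈ l) : a i ^ k i ∈ IsLocalRing.maximalIdeal A :=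
    Ideal.pow_mem_of_mem _ (ha i hi) _ (hk i hi)
  induction l generalizing rest with
  | nil => exact h
  | cons i l ih =>
    rw [List.forall_mem_cons] at hk ha hpow
    have h1 : IsWeaklyRegular A ((l.map a ++ rest) ++ [a i]) := by
      refine IsLocalRing.isWeaklyRegular_of_perm_of_subset_maximalIdeal h ?_ ?_
      · exact (List.perm_append_singleton _ _).symm
      · intro r hr
        simp only [List.map_cons, List.cons_append, List.mem_cons, List.mem_append,
          List.mem_map] at hr
        rcases hr with rfl | ⟨j, hj, rfl⟩ | hr
        exacts [ha.1, ha.2 _ hj, hrest _ hr]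
    have h2 : IsWeaklyRegular A ((l.map a ++ rest) ++ [a i ^ k i]) := by
      rw [isWeaklyRegular_append_singleton_iff] at h1 ⊢
      refine ⟨h1.1, ?_⟩
      generalize k i = n
      induction n with
      | zero => intro z hz; simpa using hz
      | succ n ihn =>
        intro z hz
        refine h1.2 _ (ihn _ ?_)
        rwa [← mul_assoc, ← pow_succ]
    have h3 : IsWeaklyRegular A (l.map a ++ (a i ^ k i :: rest)) := by
      refine IsLocalRing.isWeaklyRegular_of_perm_of_subset_maximalIdeal h2 ?_ ?_
      · rw [List.append_assoc]
        exact List.Perm.append_left _ (List.perm_append_singleton _ _)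
      · intro r hr
        simp only [List.mem_cons, List.mem_append, List.mem_map, List.not_mem_nil, or_false] at hr
        rcases hr with (⟨j, hj, rfl⟩ | hr) | rfl
        exacts [ha.2 _ hj, hrest _ hr, hpow.1]
    refine IsLocalRing.isWeaklyRegular_of_perm_of_subset_maximalIdeal (ih hk.2 ha.2 _ ?_ h3 hpow.2) ?_ ?_
    · intro r hr
      rcases List.mem_cons.1 hr with rfl | hr
      exacts [hpow.1, hrest _ hr]
    · exact List.perm_middle
    · intro r hr
      simp only [List.mem_cons, List.mem_append, List.mem_map] at hr
      rcases hr with ⟨j, hj, rfl⟩ | rfl | hr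
      exacts [hpow.2 _ hj, hpow.1, hrest _ hr]

theorem isWeaklyRegular_map_mk {A : Type*} [CommRing A] (ys : List A) (l : List A)
    (h : IsWeaklyRegular A (ys ++ l)) :
    IsWeaklyRegular (A ⧸ Ideal.ofList ys) (l.map (Ideal.Quotient.mk (Ideal.ofList ys))) := by
  induction l using List.reverseRecOn with
  | nil => exact .nil _ _
  | append_singleton l r ih =>
    rw [← List.append_assoc, isWeaklyRegular_append_singleton_iff] at h
    rw [List.map_append, List.map_singleton, isWeaklyRegular_append_singleton_iff]
    refine ⟨ih h.1, fun z hz => ?_⟩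
    obtain ⟨z, rfl⟩ := Ideal.Quotient.mk_surjective z
    have key (w : A) : Ideal.Quotient.mk (Ideal.ofList ys) w ∈
        Ideal.ofList (l.map (Ideal.Quotient.mk (Ideal.ofList ys))) ↔
        w ∈ Ideal.ofList (ys ++ l) := by
      rw [← Ideal.map_ofList, Ideal.mem_quotient_iff_mem_sup, Ideal.ofList_append, sup_comm]
    rw [← map_mul, key] at hz
    exact (key _).2 (h.2 _ hz)

section MvPolynomial

variable {S : Type*} [CommRing S] {σ : Type*}

theorem ofList_map_X (l : List σ) : Ideal.ofList (l.map (MvPolynomial.X (R := S))) =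
    Ideal.span (MvPolynomial.X '' {i | i ∈ l}) := by
  unfold Ideal.ofList
  congr 1
  ext z
  simp

/-- Membership in an ideal of variables is read off the monomials of the support, and multiplying by
a different variable does not affect it. -/
theorem isWeaklyRegular_map_X (l : List σ) (hl : l.Nodup) :
    IsWeaklyRegular (MvPolynomial σ S) (l.map (MvPolynomial.X (R := S))) := by
  induction l using List.reverseRecOn with
  | nil => exact .nil _ _
  | append_singleton l j ih =>
    rw [List.nodup_append] at hl
    rw [List.map_append, List.map_singleton, isWeaklyRegular_append_singleton_iff]
    refine ⟨ih hl.1, fun z hz => ?_⟩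
    rw [ofList_map_X, MvPolynomial.mem_ideal_span_X_image] at hz ⊢
    intro m hm
    obtain ⟨i, hi, hmi⟩ := hz (Finsupp.single j 1 + m) (by
      rw [MvPolynomial.mem_support_iff, MvPolynomial.coeff_X_mul]
      exact MvPolynomial.mem_support_iff.1 hm)
    refine ⟨i, hi, ?_⟩
    have : j ≠ i := fun h => hl.2.2 i hi j (by simp) h.symm
    simpa [Finsupp.single_apply, this] using hmi

theorem sub_C_constantCoeff_mem (L : List σ) (hL : ∀ i, i ∈ L) (z : MvPolynomial σ S) :
    z - MvPolynomial.C (MvPolynomial.constantCoeff z) ∈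
      Ideal.ofList (L.map (MvPolynomial.X (R := S))) := by
  rw [ofList_map_X, MvPolynomial.mem_ideal_span_X_image]
  intro m hm
  by_contra! h
  have h0 : m = 0 := by
    ext i
    exact h i (hL i)
  rw [MvPolynomial.mem_support_iff, h0] at hm
  simp [MvPolynomial.constantCoeff_eq] at hm

/-- Since L contains every variable, Y w is congruent to its constant coefficient modulo the
variables. -/
theorem ofList_map_X_append (L : List σ) (hL : ∀ i, i ∈ L) {ι : Type*}
    (Y : ι → MvPolynomial σ S) (ws : List ι) :
    Ideal.ofList (L.map MvPolynomial.X ++ ws.map Y) = Ideal.comap MvPolynomial.constantCoeff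
      (Ideal.ofList (ws.map fun w => MvPolynomial.constantCoeff (Y w))) := by
  apply le_antisymm
  · refine Ideal.span_le.2 fun z hz => ?_
    simp only [Set.mem_ofPred_eq, List.mem_append, List.mem_map] at hz
    rw [SetLike.mem_coe, Ideal.mem_comap]
    rcases hz with ⟨i, -, rfl⟩ | ⟨w, hw, rfl⟩
    · simp
    · exact Ideal.subset_span (List.mem_map.2 ⟨w, hw, rfl⟩)
  · intro z hz
    rw [Ideal.ofList_append]
    have h1 : Ideal.map MvPolynomial.C
        (Ideal.ofList (ws.map fun w => MvPolynomial.constantCoeff (Y w))) ≤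
        Ideal.ofList (L.map MvPolynomial.X) ⊔ Ideal.ofList (ws.map Y) := by
      rw [Ideal.map_ofList]
      refine Ideal.span_le.2 fun z hz => ?_
      simp only [Set.mem_ofPred_eq, List.mem_map, exists_exists_and_eq_and] at hz
      obtain ⟨w, hw, rfl⟩ := hz
      rw [← sub_sub_self (Y w) (MvPolynomial.C _)]
      exact sub_mem (Ideal.mem_sup_right (Ideal.subset_span (List.mem_map.2 ⟨w, hw, rfl⟩)))
        (Ideal.mem_sup_left (sub_C_constantCoeff_mem L hL _))
    rw [← sub_add_cancel z (MvPolynomial.C (MvPolynomial.constantCoeff z))]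
    exact add_mem (Ideal.mem_sup_left (sub_C_constantCoeff_mem L hL _))
      (h1 (Ideal.mem_map_of_mem _ hz))

theorem isWeaklyRegular_map_X_append (L : List σ) (hL : ∀ i, i ∈ L) (hL' : L.Nodup) {ι : Type*}
    (Y : ι → MvPolynomial σ S) (ws : List ι)
    (h : IsWeaklyRegular S (ws.map fun w => MvPolynomial.constantCoeff (Y w))) :
    IsWeaklyRegular (MvPolynomial σ S) (L.map MvPolynomial.X ++ ws.map Y) := by
  induction ws using List.reverseRecOn with
  | nil => simpa using isWeaklyRegular_map_X L hL'
  | append_singleton ws w ih =>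
    rw [List.map_append, List.map_singleton, isWeaklyRegular_append_singleton_iff] at h
    rw [List.map_append, List.map_singleton, ← List.append_assoc,
      isWeaklyRegular_append_singleton_iff, ofList_map_X_append L hL]
    refine ⟨ih h.1, fun z hz => h.2 _ ?_⟩
    rwa [Ideal.mem_comap, map_mul] at hz

end MvPolynomial

/-! ### The cover of R by a ring with regular parameters -/

/-- In a Cohen-Macaulay local ring there is a regular sequence in the maximal ideal that generates
an ideal with radical the maximal ideal. -/
theorem IsCohenMacaulayLocalRing.exists_isRegular {S : Type*} [CommRing S] [IsLocalRing S]
    (hS : IsCohenMacaulayLocalRing S) : ∃ ws : List S, IsRegular S ws ∧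
      (∀ w ∈ ws, w ∈ IsLocalRing.maximalIdeal S) ∧
      IsLocalRing.maximalIdeal S ≤ (Ideal.ofList ws).radical := by
  have : IsNoetherianRing S := hS.1
  have hne : Nonempty {rs : List S // IsRegular S rs ∧
    ∀ r ∈ rs, r ∈ IsLocalRing.maximalIdeal S} := ⟨⟨[], .nil _ _, by simp⟩⟩
  have hlt : depth S < ⊤ := by
    have h : ringKrullDim S < ⊤ := ringKrullDim_lt_top
    rw [← hS.2] at h
    exact WithBot.coe_lt_coe.1 h
  -- The depth is finite, so it is attained. A regular sequence of length dim S leaves a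
  -- zero-dimensional quotient, so every prime containing it is maximal.
  obtain ⟨⟨ws, hws, hm⟩, hd⟩ := ENat.exists_eq_iSup_of_lt_top hlt
  refine ⟨ws, hws, hm, ?_⟩
  have hdim := ringKrullDim_add_length_eq_ringKrullDim_of_isRegular ws hws
  rw [← hS.2, depth, ← hd] at hdim
  have h0 : ringKrullDim (S ⧸ Ideal.ofList ws) = 0 := by
    refine ENat.WithBot.add_natCast_cancel (c := ws.length).1 ?_
    rw [hdim, zero_add]
    rfl
  have hK : Ring.KrullDimLE 0 (S ⧸ Ideal.ofList ws) := by
    rw [Ring.krullDimLE_iff, h0]; rfl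
  rw [Ideal.radical_eq_sInf]
  refine le_sInf fun J hJ => ?_
  have := hJ.2
  have hJ' : (Ideal.map (Ideal.Quotient.mk (Ideal.ofList ws)) J).IsPrime :=
    Ideal.map_isPrime_of_surjective Ideal.Quotient.mk_surjective (by simpa using hJ.1)
  have h1 := hJ'.isMaximal'
  have h2 := Ideal.comap_isMaximal_of_surjective _ Ideal.Quotient.mk_surjective (K := Ideal.map
    (Ideal.Quotient.mk (Ideal.ofList ws)) J)
  rw [Ideal.comap_map_of_surjective _ Ideal.Quotient.mk_surjective, ← RingHom.ker_eq_comap_bot,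
    Ideal.mk_ker, sup_eq_left.2 hJ.1] at h2
  exact (IsLocalRing.eq_maximalIdeal h2).ge

theorem IsSystemOfParameters.mem_maximalIdeal {R : Type*} [CommRing R] [IsLocalRing R] {d : ℕ}
    {x : Fin d → R} (hx : IsSystemOfParameters x) (j : Fin d) :
    x j ∈ IsLocalRing.maximalIdeal R :=
  hx.2 ▸ Ideal.le_radical (Ideal.subset_span ⟨j, rfl⟩)

/-- A Noetherian ring `B` of dimension at most `dim R / P` for all minimal primes `P` of `R` that
maps onto `R` pulls back minimal primes of `R` to minimal primes. -/
theorem comap_mem_minimalPrimes_of_ringKrullDim_le {B : Type*} {R : Type*} [CommRing B]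
    [CommRing R] (φ : B →+* R) (hφ : Function.Surjective φ) {P : Ideal R} (hP : P.IsPrime) {d : ℕ}
    (hd : (d : WithBot ℕ∞) = ringKrullDim (R ⧸ P)) (hB : ringKrullDim B ≤ d) :
    P.comap φ ∈ minimalPrimes B := by
  refine ⟨⟨hP.comap φ, bot_le⟩, fun Q hQ hQP => ?_⟩
  have hQp : Q.IsPrime := hQ.1
  by_contra hle
  obtain ⟨r, hr, hrQ⟩ := SetLike.not_le_iff_exists.1 hle
  let ψ : B ⧸ Q →+* R ⧸ P := Ideal.quotientMap P φ hQP
  have hψ : Function.Surjective ψ := Ideal.quotientMap_surjective hφ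
  -- If Q were strictly smaller, the domain B/Q would map onto R/P with a nonzero element in the
  -- kernel, forcing dim B ≥ d + 1.
  have h1 : ringKrullDim (R ⧸ P) + 1 ≤ ringKrullDim (B ⧸ Q) := by
    refine ringKrullDim_succ_le_of_surjective ψ hψ (r := Ideal.Quotient.mk Q r) ?_ ?_
    · exact mem_nonZeroDivisors_of_ne_zero (by rwa [Ne, Ideal.Quotient.eq_zero_iff_mem])
    · rw [Ideal.quotientMap_mk, Ideal.Quotient.eq_zero_iff_mem]; exact hr
  have h2 := (h1.trans (ringKrullDim_quotient_le Q)).trans hB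
  rw [← hd] at h2
  have h3 : d + 1 ≤ d := by exact_mod_cast h2
  omega

theorem ringKrullDim_le_of_maximalIdeal_le_radical {B : Type*} [CommRing B] [IsLocalRing B]
    [IsNoetherianRing B] {d : ℕ} (t : Fin d → B)
    (h : (Ideal.span (Set.range t)).radical = IsLocalRing.maximalIdeal B) : ringKrullDim B ≤ d := by
  rw [← IsLocalRing.maximalIdeal_height_eq_ringKrullDim]
  have hmin : IsLocalRing.maximalIdeal B ∈ (Ideal.span (Set.range t)).minimalPrimes := by
    refine ⟨⟨inferInstance, h ▸ Ideal.le_radical⟩, fun J hJ _ => ?_⟩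
    rw [← h]
    exact hJ.1.radical_le_iff.2 hJ.2
  have h1 := Ideal.height_le_card_of_mem_minimalPrimes_span (Set.finite_range t) hmin
  have h2 : (Set.range t).ncard ≤ d := by
    rw [← Set.image_univ]
    exact (Set.ncard_image_le).trans (by simp)
  have h3 : (IsLocalRing.maximalIdeal B).height ≤ (d : ℕ∞) := h1.trans (by exact_mod_cast h2)
  exact_mod_cast h3

theorem map_mem_maximalIdeal_iff {A B : Type*} [CommRing A] [CommRing B] [IsLocalRing A]
    [IsLocalRing B] {g : A →+* B} (hg : Function.Surjective g) {z : A} :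
    g z ∈ IsLocalRing.maximalIdeal B ↔ z ∈ IsLocalRing.maximalIdeal A := by
  have : IsLocalHom g := .of_surjective g hg
  rw [← Ideal.mem_comap, IsLocalRing.maximalIdeal_comap]

/-- A homomorphic image `R` of a Cohen-Macaulay local ring is a homomorphic image of a Noetherian
ring `B` with `dim B ≤ d` such that the system of parameters lifts to elements whose powers form
weakly regular sequences in any order: `B` is a quotient of a localization of `S[T₁, …, T_d]`. -/
theorem exists_cover {R : Type v} [CommRing R] [IsLocalRing R]
    {S : Type u} [CommRing S] [IsLocalRing S] (hS : IsCohenMacaulayLocalRing S)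
    (f : S →+* R) (hf : Function.Surjective f) {d : ℕ} (x : Fin d → R)
    (hx : IsSystemOfParameters x) :
    ∃ (B : Type u) (_ : CommRing B) (φ : B →+* R) (t : Fin d → B), IsNoetherianRing B ∧
      Function.Surjective φ ∧ (∀ j, φ (t j) = x j) ∧ ringKrullDim B ≤ d ∧
      ∀ (l : List (Fin d)) (k : Fin d → ℕ), l.Nodup → (∀ j, 0 < k j) →
        IsWeaklyRegular B (l.map fun j => t j ^ k j) := by
  have hSN : IsNoetherianRing S := hS.1
  obtain ⟨ws, hws, hwm, hrad⟩ := hS.exists_isRegular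
  -- A power of f w is a combination ∑ b_j x_j. Lifting the b_j to S gives y = w^k - ∑ b'_j T_j,
  -- which vanishes in R and has constant term w^k.
  have hY (w : S) (hw : w ∈ ws) : ∃ (y : MvPolynomial (Fin d) S) (k : ℕ), 0 < k ∧
      MvPolynomial.eval₂Hom f x y = 0 ∧ MvPolynomial.constantCoeff y = w ^ k := by
    have h1 : f w ∈ (Ideal.span (Set.range x)).radical := by
      rw [hx.2]
      exact (map_mem_maximalIdeal_iff hf).2 (hwm w hw)
    obtain ⟨k, hk⟩ := h1
    have hk' : f w ^ (k + 1) ∈ Ideal.span (Set.range x) := by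
      rw [pow_succ']; exact Ideal.mul_mem_left _ _ hk
    obtain ⟨b, hb⟩ := (Ideal.mem_span_range_iff_exists_fun).1 hk'
    choose b' hb' using fun j => hf (b j)
    refine ⟨MvPolynomial.C (w ^ (k + 1)) - ∑ j, MvPolynomial.C (b' j) * MvPolynomial.X j, k + 1,
      k.succ_pos, ?_, ?_⟩
    · simp [hb', hb]
    · simp
  choose! Y k hk hYe hYc using hY
  let ev := MvPolynomial.eval₂Hom f x
  have hev : Function.Surjective ev := fun r => by
    obtain ⟨s, rfl⟩ := hf r
    exact ⟨MvPolynomial.C s, by simp [ev]⟩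
  let N : Ideal (MvPolynomial (Fin d) S) := (IsLocalRing.maximalIdeal R).comap ev
  have hN : N.IsPrime := Ideal.IsPrime.comap ev
  obtain ⟨A, iA, iAlg, iLoc⟩ : ∃ (A : Type u) (_ : CommRing A)
      (_ : Algebra (MvPolynomial (Fin d) S) A), IsLocalization.AtPrime A N :=
    ⟨Localization.AtPrime N, inferInstance, inferInstance, inferInstance⟩
  have iAloc : IsLocalRing A := IsLocalization.AtPrime.isLocalRing A N
  have hAN : IsNoetherianRing A := IsLocalization.isNoetherianRing N.primeCompl A inferInstance
  let a : MvPolynomial (Fin d) S →+* A := algebraMap _ A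
  let φA : A →+* R := IsLocalization.lift (M := N.primeCompl) (g := ev) fun s => by
    by_contra h
    exact s.2 ((IsLocalRing.mem_maximalIdeal _).2 h)
  have hφa (z) : φA (a z) = ev z := IsLocalization.lift_eq _ _
  let ys : List A := ws.map fun w => a (Y w)
  have hys : Ideal.ofList ys ≤ RingHom.ker φA := by
    refine Ideal.span_le.2 fun z hz => ?_
    obtain ⟨w, hw, rfl⟩ := List.mem_map.1 hz
    rw [SetLike.mem_coe, RingHom.mem_ker, hφa]
    exact hYe w hw
  have haN {z} (hz : z ∈ N) : a z ∈ IsLocalRing.maximalIdeal A :=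
    (IsLocalization.AtPrime.to_map_mem_maximal_iff A N z).2 hz
  have hXN (j : Fin d) : MvPolynomial.X j ∈ N := by
    rw [Ideal.mem_comap]
    simpa [ev] using hx.mem_maximalIdeal j
  have hYN (w) (hw : w ∈ ws) : Y w ∈ N := by
    rw [Ideal.mem_comap, show ev (Y w) = 0 from hYe w hw]
    exact zero_mem _
  have hysN : ∀ y ∈ ys, y ∈ IsLocalRing.maximalIdeal A := by
    intro y hy
    obtain ⟨w, hw, rfl⟩ := List.mem_map.1 hy
    exact haN (hYN w hw)
  have hcc : ws.map (fun w => MvPolynomial.constantCoeff (Y w)) = ws.map fun w => w ^ k w :=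
    List.map_congr_left hYc
  have hreg1 : IsWeaklyRegular S (ws.map fun w => MvPolynomial.constantCoeff (Y w)) := by
    rw [hcc]
    simpa using isWeaklyRegular_map_pow_append (fun w => w) k ws hk hwm [] (by simp)
      (by simpa using hws.toIsWeaklyRegular)
  -- The T_j followed by the Y_w are weakly regular in S[T], because modulo the T_j the Y_w become
  -- the powers w^k. Localizing at N makes the order irrelevant.
  have hreg2 := (isWeaklyRegular_map_X_append (List.finRange d) (List.mem_finRange)
    (List.nodup_finRange d) Y ws hreg1).of_isLocalization A N.primeCompl
  rw [List.map_append, List.map_map, List.map_map] at hreg2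
  let I := Ideal.ofList ys
  have hI : I ≠ ⊤ := fun h => RingHom.ker_ne_top φA (top_le_iff.1 (h ▸ hys))
  have : Nontrivial (A ⧸ I) := Ideal.Quotient.nontrivial_iff.2 hI
  have hloc : IsLocalRing (A ⧸ I) := .of_surjective' _ Ideal.Quotient.mk_surjective
  have hmk {z} (hz : z ∈ IsLocalRing.maximalIdeal A) :
      Ideal.Quotient.mk I z ∈ IsLocalRing.maximalIdeal (A ⧸ I) :=
    (map_mem_maximalIdeal_iff Ideal.Quotient.mk_surjective).2 hz
  -- An element of N has constant term in the maximal ideal of S, which is contained in the radical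
  -- of the ideal of the w^k. Once the Y_w are killed, the T_j therefore generate an ideal with
  -- radical the maximal ideal, whence dim ≤ d.
  have hradN : N ≤ (Ideal.ofList ((List.finRange d).map MvPolynomial.X ++ ws.map Y)).radical := by
    intro g hg
    rw [ofList_map_X_append _ List.mem_finRange, hcc, ← Ideal.comap_radical, Ideal.mem_comap]
    have h0 : MvPolynomial.constantCoeff g ∈ IsLocalRing.maximalIdeal S := by
      rw [← map_mem_maximalIdeal_iff hf]
      have h1 : ev (g - MvPolynomial.C (MvPolynomial.constantCoeff g)) ∈
          IsLocalRing.maximalIdeal R := by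
        have h2 := sub_C_constantCoeff_mem (List.finRange d) List.mem_finRange g
        refine (Ideal.span_le (I := N)).2 ?_ h2
        intro z hz
        obtain ⟨j, -, rfl⟩ := List.mem_map.1 hz
        exact hXN j
      have h3 := sub_mem (Ideal.mem_comap.1 hg) h1
      rw [map_sub, sub_sub_cancel] at h3
      simpa [ev] using h3
    refine Ideal.radical_le_radical_iff.2 ?_ (hrad h0)
    exact Ideal.span_le.2 fun w hw => ⟨k w, Ideal.subset_span (List.mem_map.2 ⟨w, hw, rfl⟩)⟩
  refine ⟨A ⧸ I, inferInstance, Ideal.Quotient.lift I φA fun z hz => RingHom.mem_ker.1 (hys hz),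
    fun j => Ideal.Quotient.mk I (a (MvPolynomial.X j)), inferInstance, ?_, ?_, ?_, ?_⟩
  · intro r
    obtain ⟨z, rfl⟩ := hev r
    exact ⟨Ideal.Quotient.mk I (a z), hφa z⟩
  · intro j
    exact (hφa _).trans (by simp [ev])
  · refine ringKrullDim_le_of_maximalIdeal_le_radical
      (fun j => Ideal.Quotient.mk I (a (MvPolynomial.X j))) (le_antisymm ?_ ?_)
    · rw [(IsLocalRing.maximalIdeal.isMaximal (A ⧸ I)).isPrime.radical_le_iff, Ideal.span_le]
      rintro _ ⟨j, rfl⟩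
      exact hmk (haN (hXN j))
    · intro z hz
      obtain ⟨z, rfl⟩ := Ideal.Quotient.mk_surjective z
      obtain ⟨g, s, rfl⟩ := IsLocalization.exists_mk'_eq N.primeCompl z
      have hgN : g ∈ N := by
        rw [← IsLocalization.AtPrime.mk'_mem_maximal_iff A N g s]
        exact (map_mem_maximalIdeal_iff Ideal.Quotient.mk_surjective).1 hz
      obtain ⟨n, hn⟩ := hradN hgN
      have h1 := Ideal.mem_map_of_mem a hn
      rw [Ideal.map_ofList, List.map_append, List.map_map, List.map_map] at h1
      have h2 := Ideal.mem_map_of_mem (Ideal.Quotient.mk I) h1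
      have hle : Ideal.map (Ideal.Quotient.mk I) (Ideal.ofList (List.map (a ∘ MvPolynomial.X)
          (List.finRange d) ++ List.map (a ∘ Y) ws)) ≤ Ideal.span (Set.range fun j =>
          Ideal.Quotient.mk I (a (MvPolynomial.X j))) := by
        rw [Ideal.map_ofList]
        refine Ideal.span_le.2 fun z hz => ?_
        simp only [Set.mem_ofPred_eq, List.map_append, List.map_map, List.mem_append,
          List.mem_map] at hz
        rcases hz with ⟨j, -, rfl⟩ | ⟨w, hw, rfl⟩
        · exact Ideal.subset_span ⟨j, rfl⟩
        · have : (Ideal.Quotient.mk I ∘ a ∘ Y) w = 0 :=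
            Ideal.Quotient.eq_zero_iff_mem.2 (Ideal.subset_span (List.mem_map.2 ⟨w, hw, rfl⟩))
          rw [this]
          exact zero_mem _
      rw [IsLocalization.mk'_eq_mul_mk'_one, map_mul]
      refine Ideal.mul_mem_right _ _ ⟨n, ?_⟩
      rw [← map_pow, ← map_pow]
      exact hle h2
  · intro l k hl hk
    -- The full sequence is permuted so that l and the Y_w come first, and the remaining T_j are
    -- dropped. The entries of l are then raised to powers, and the Y_w are moved to the front to be
    -- factored out.
    have h1 : IsWeaklyRegular A (l.map (fun j => a (MvPolynomial.X j)) ++ ys) := by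
      have hp : (l ++ (List.finRange d).filter (fun j => j ∉ l)).Perm (List.finRange d) := by
        rw [List.perm_ext_iff_of_nodup _ (List.nodup_finRange d)]
        · intro j
          simpa using Classical.em _
        · refine hl.append ((List.nodup_finRange d).filter _) ?_
          intro j hj hj'
          simp [hj] at hj'
      have h2 := IsLocalRing.isWeaklyRegular_of_perm_of_subset_maximalIdeal hreg2
        (rs' := (l.map (fun j => a (MvPolynomial.X j)) ++ ys) ++
          ((List.finRange d).filter (fun j => j ∉ l)).map (fun j => a (MvPolynomial.X j))) ?_ ?_
      · exact ((isWeaklyRegular_append_iff _ _ _).1 h2).1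
      · refine List.Perm.trans ?_ (?_ : List.Perm ((l.map (fun j => a (MvPolynomial.X j)) ++
          ((List.finRange d).filter (fun j => j ∉ l)).map (fun j => a (MvPolynomial.X j))) ++ ys) _)
        · rw [← List.map_append]
          exact ((hp.map _).symm).append_right _
        · rw [List.append_assoc, List.append_assoc]
          exact List.perm_append_comm.append_left _
      · intro r hr
        rcases List.mem_append.1 hr with hr | hr
        · obtain ⟨j, -, rfl⟩ := List.mem_map.1 hr
          exact haN (hXN j)
        · exact hysN r hr
    have h2 := isWeaklyRegular_map_pow_append (fun j => a (MvPolynomial.X j)) k l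
      (fun j _ => hk j) (fun j _ => haN (hXN j)) ys hysN h1
    have h3 := IsLocalRing.isWeaklyRegular_of_perm_of_subset_maximalIdeal h2
      List.perm_append_comm ?_
    · have h4 := isWeaklyRegular_map_mk _ _ h3
      rw [List.map_map] at h4
      exact h4
    · intro r hr
      rcases List.mem_append.1 hr with hr | hr
      · obtain ⟨j, -, rfl⟩ := List.mem_map.1 hr
        exact Ideal.pow_mem_of_mem _ (haN (hXN j)) _ (hk j)
      · exact hysN r hr

/-! ### Uniform annihilation of colons of parameters in R -/

/-- The ideal generated by the powers `x_k ^ n_k` with `k ∈ Λ`. -/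
def powerIdeal {R : Type*} [CommRing R] {ι : Type*} (x : ι → R) (n : ι → ℕ) (Λ : Set ι) :
    Ideal R :=
  Ideal.span ((fun k => x k ^ n k) '' Λ)

theorem mk_mem_smul_top_iff {B R : Type*} [CommRing B] [CommRing R] (φ : B →+* R)
    (hφ : Function.Surjective φ) (I : Ideal B) (w : B) :
    (Submodule.Quotient.mk w : B ⧸ RingHom.ker φ) ∈ (I • ⊤ : Submodule B (B ⧸ RingHom.ker φ)) ↔
      φ w ∈ I.map φ := by
  rw [← map_smul_top_of_surjective (g := (RingHom.ker φ).mkQ) I (Submodule.mkQ_surjective _),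
    ← Ideal.mem_comap, Ideal.comap_map_of_surjective φ hφ, ← RingHom.ker_eq_comap_bot, sup_comm,
    ← Submodule.comap_map_mkQ, Submodule.mem_comap]
  simp

/-- The elements killing all these colons form an ideal 𝔠. For each minimal prime P,
equidimensionality makes its contraction to the cover minimal, so `exists_colonKills` puts an
element of 𝔠 outside P. As there are finitely many P, prime avoidance concludes. -/
theorem exists_uniform_colon_of_isLocalRing {R : Type v} [CommRing R] [IsLocalRing R]
    [IsNoetherianRing R] (hR : IsEquidimensional R)
    {S : Type u} [CommRing S] [IsLocalRing S] (hS : IsCohenMacaulayLocalRing S)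
    (f : S →+* R) (hf : Function.Surjective f) {d : ℕ} (x : Fin d → R)
    (hx : IsSystemOfParameters x) :
    ∃ c ∈ minimalPrimesCompl R, ∀ (Λ : Set (Fin d)) (n : Fin d → ℕ) (j : Fin d), (∀ k, 0 < n k) →
      j ∉ Λ → ∀ z, x j ^ n j * z ∈ powerIdeal x n Λ → c * z ∈ powerIdeal x n Λ := by
  classical
  obtain ⟨B, _, φ, t, hB, hφ, hφt, hdim, hreg⟩ := exists_cover hS f hf x hx
  let 𝔠 : Ideal R :=
    { carrier := {c | ∀ (Λ : Set (Fin d)) (n : Fin d → ℕ) (j : Fin d), (∀ k, 0 < n k) →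
        j ∉ Λ → ∀ z, x j ^ n j * z ∈ powerIdeal x n Λ → c * z ∈ powerIdeal x n Λ}
      zero_mem' := fun Λ n j _ _ z _ => by simp
      add_mem' := fun ha hb Λ n j hn hj z hz => by
        rw [add_mul]
        exact add_mem (ha Λ n j hn hj z hz) (hb Λ n j hn hj z hz)
      smul_mem' := fun r a ha Λ n j hn hj z hz => by
        rw [smul_eq_mul, mul_assoc]
        exact Ideal.mul_mem_left _ _ (ha Λ n j hn hj z hz) }
  have key (P) (hP : P ∈ minimalPrimes R) : ¬ 𝔠 ≤ P := by
    have hPB := comap_mem_minimalPrimes_of_ringKrullDim_le φ hφ hP.1.1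
      (hx.1.trans (hR P hP).symm) hdim
    obtain ⟨b, hb, hkill⟩ := exists_colonKills hPB (d + 1) (B ⧸ RingHom.ker φ) inferInstance
    refine fun hle => hb (hle (?_ : φ b ∈ 𝔠))
    intro Λ n j hn hj z hz
    obtain ⟨z, rfl⟩ := hφ z
    let l : List (Fin d) := Λ.toFinset.toList
    have hlj : (l ++ [j]).Nodup := by
      refine (Finset.nodup_toList _).append (List.nodup_singleton j) ?_
      simpa [l, List.disjoint_singleton] using hj
    have hmap : (Ideal.ofList (l.map fun k => t k ^ n k)).map φ = powerIdeal x n Λ := by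
      rw [Ideal.map_ofList, List.map_map, powerIdeal, Ideal.ofList]
      congr 1
      ext w
      simp [l, hφt]
    have hlen := hlj.length_le_card
    rw [List.length_append, Fintype.card_fin] at hlen
    have hw := hreg (l ++ [j]) n hlj hn
    rw [List.map_append, List.map_singleton] at hw
    have h1 := hkill (l.map fun k => t k ^ n k) (t j ^ n j) (by simp; omega) hw
      (Submodule.Quotient.mk z)
    rw [← Submodule.Quotient.mk_smul, ← Submodule.Quotient.mk_smul, mk_mem_smul_top_iff φ hφ,
      mk_mem_smul_top_iff φ hφ, hmap, smul_eq_mul, smul_eq_mul, map_mul, map_mul, map_pow,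
      hφt] at h1
    exact h1 hz
  by_contra! hcon
  have hsub : (𝔠 : Set R) ⊆ ⋃ P ∈ minimalPrimes R, (P : Set R) := by
    intro c hc
    by_contra h
    obtain ⟨Λ, n, j, hn, hj, z, hz, hz'⟩ := hcon c fun P hP hcP =>
      h (Set.mem_biUnion hP hcP)
    exact hz' (hc Λ n j hn hj z hz)
  obtain ⟨P, hP, hle⟩ := (Ideal.subset_union_prime_finite
    (minimalPrimes.finite_of_isNoetherianRing R) (f := id) ⊥ ⊥ fun P hP _ _ => hP.1.1).1 hsub
  exact key P hP hle

theorem exists_uniform_colon {R : Type v} [CommRing R] [IsLocalRing R]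
    [IsNoetherianRing R] (hR : IsEquidimensional R)
    {S : Type u} [CommRing S] (hS : IsCohenMacaulayRing S)
    (f : S →+* R) (hf : Function.Surjective f) {d : ℕ} (x : Fin d → R)
    (hx : IsSystemOfParameters x) :
    ∃ c ∈ minimalPrimesCompl R, ∀ (Λ : Set (Fin d)) (n : Fin d → ℕ) (j : Fin d), (∀ k, 0 < n k) →
      j ∉ Λ → ∀ z, x j ^ n j * z ∈ powerIdeal x n Λ → c * z ∈ powerIdeal x n Λ := by
  let M : Ideal S := (IsLocalRing.maximalIdeal R).comap f
  have hM : M.IsMaximal := Ideal.comap_isMaximal_of_surjective f hf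
  have hunit (s : M.primeCompl) : IsUnit (f s) := by
    by_contra h
    exact s.2 ((IsLocalRing.mem_maximalIdeal _).2 h)
  refine exists_uniform_colon_of_isLocalRing hR (hS.2 M)
    (IsLocalization.lift (M := M.primeCompl) (S := Localization.AtPrime M) hunit) (fun r => ?_) x hx
  obtain ⟨s, rfl⟩ := hf r
  exact ⟨algebraMap _ _ s, IsLocalization.lift_eq _ _⟩

/-! ### Colon capturing and test elements -/

section CharP

variable {R : Type*} [CommRing R] {p : ℕ} [Fact p.Prime] [CharP R p]

/-- The bracket power is the extension of the ideal along the iterated Frobenius, and extension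
commutes with spans. -/
theorem bracketPower_span (s : Set R) (e : ℕ) :
    bracketPower (Ideal.span s) (p ^ e) = Ideal.span ((fun r => r ^ p ^ e) '' s) := by
  have h := Ideal.map_span (iterateFrobenius R p e) s
  exact h

theorem bracketPower_powerIdeal {ι : Type*} (x : ι → R) (n : ι → ℕ) (Λ : Set ι) (e : ℕ) :
    bracketPower (powerIdeal x n Λ) (p ^ e) = powerIdeal x (fun k => n k * p ^ e) Λ := by
  rw [powerIdeal, bracketPower_span, Set.image_image]
  simp only [← pow_mul]
  rfl

theorem bracketPower_mono {I J : Ideal R} (h : I ≤ J) (q : ℕ) :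
    bracketPower I q ≤ bracketPower J q :=
  Ideal.span_mono (Set.image_mono h)

theorem tightClosure_mono {I J : Ideal R} (h : I ≤ J) : tightClosure p I ≤ tightClosure p J := by
  rintro z ⟨c, hc, e₀, hz⟩
  exact ⟨c, hc, e₀, fun e he => bracketPower_mono h _ (hz e he)⟩

theorem le_tightClosure (I : Ideal R) : I ≤ tightClosure p I := fun z hz =>
  ⟨1, one_mem_minimalPrimesCompl R, 0, fun e _ => by
    rw [one_mul]; exact Ideal.subset_span ⟨z, hz, rfl⟩⟩

/-- A family satisfies colon capturing for powers of its members, and its members annihilate the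
tight closures of the ideals generated by such powers. -/
structure IsTestFamily (p : ℕ) [Fact p.Prime] {R : Type*} [CommRing R] [CharP R p] {ι : Type*}
    (x : ι → R) : Prop where
  mem_compl : ∀ j, x j ∈ minimalPrimesCompl R
  colon : ∀ (Λ : Set ι) (n : ι → ℕ) (j : ι), (∀ k, 0 < n k) → j ∉ Λ → ∀ z,
    x j ^ n j * z ∈ powerIdeal x n Λ → z ∈ tightClosure p (powerIdeal x n Λ)
  mul_mem : ∀ (Λ : Set ι) (n : ι → ℕ) (j : ι), (∀ k, 0 < n k) → ∀ z,
    z ∈ tightClosure p (powerIdeal x n Λ) → x j * z ∈ powerIdeal x n Λ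

/-- Taking q-th powers of the relation multiplies all exponents by q, and the same c still applies.
-/
theorem mem_tightClosure_of_uniform_colon {ι : Type*} {x : ι → R} {c : R}
    (hc : c ∈ minimalPrimesCompl R)
    (h : ∀ (Λ : Set ι) (n : ι → ℕ) (j : ι), (∀ k, 0 < n k) →
      j ∉ Λ → ∀ z, x j ^ n j * z ∈ powerIdeal x n Λ → c * z ∈ powerIdeal x n Λ)
    (Λ : Set ι) (n : ι → ℕ) (j : ι) (hn : ∀ k, 0 < n k) (hj : j ∉ Λ) (z : R)
    (hz : x j ^ n j * z ∈ powerIdeal x n Λ) : z ∈ tightClosure p (powerIdeal x n Λ) := by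
  refine ⟨c, hc, 0, fun e _ => ?_⟩
  rw [bracketPower_powerIdeal]
  refine h Λ _ j (fun k => Nat.mul_pos (hn k) (pow_pos (Fact.out : p.Prime).pos _)) hj _ ?_
  rw [← bracketPower_powerIdeal, pow_mul, ← mul_pow]
  exact Ideal.subset_span ⟨_, hz, rfl⟩

/-- Test elements are defined through full systems of parameters, so the family is completed by N-th
powers of the missing x_k. The case q = 1 gives c z in the ideal plus 𝔪^N for every N, and Krull's
intersection theorem removes 𝔪^N. -/
theorem mul_mem_of_isParameterTestElement [IsLocalRing R] [IsNoetherianRing R] {d : ℕ}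
    {x : Fin d → R} (hx : IsSystemOfParameters x) {c : R} (hc : IsParameterTestElement p c)
    (Λ : Set (Fin d)) (n : Fin d → ℕ) (hn : ∀ k, 0 < n k) (z : R)
    (hz : z ∈ tightClosure p (powerIdeal x n Λ)) : c * z ∈ powerIdeal x n Λ := by
  classical
  have hpow (N : ℕ) (hN : 0 < N) :
      c * z ∈ powerIdeal x n Λ ⊔ IsLocalRing.maximalIdeal R ^ N := by
    let y : Fin d → R := fun k => if k ∈ Λ then x k ^ n k else x k ^ N
    have hy : IsSystemOfParameters y := by
      refine ⟨hx.1, le_antisymm ?_ ?_⟩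
      · rw [(IsLocalRing.maximalIdeal.isMaximal R).isPrime.radical_le_iff, Ideal.span_le]
        rintro _ ⟨k, rfl⟩
        dsimp only [y]
        split_ifs
        · exact Ideal.pow_mem_of_mem _ (hx.mem_maximalIdeal k) _ (hn k)
        · exact Ideal.pow_mem_of_mem _ (hx.mem_maximalIdeal k) _ hN
      · rw [← hx.2]
        refine Ideal.radical_le_radical_iff.2 (Ideal.span_le.2 ?_)
        rintro _ ⟨k, rfl⟩
        have hk : y k ∈ Ideal.span (Set.range y) := Ideal.subset_span ⟨k, rfl⟩
        dsimp only [y] at hk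
        split_ifs at hk
        exacts [⟨_, hk⟩, ⟨_, hk⟩]
    have hle : powerIdeal x n Λ ≤ Ideal.span (Set.range y) := by
      refine Ideal.span_mono ?_
      rintro _ ⟨k, hk, rfl⟩
      exact ⟨k, if_pos hk⟩
    have h1 := hc.2 d y hy z (tightClosure_mono hle hz) 0
    rw [pow_zero, pow_one] at h1
    have hle2 : bracketPower (Ideal.span (Set.range y)) 1 ≤
        powerIdeal x n Λ ⊔ IsLocalRing.maximalIdeal R ^ N := by
      have : bracketPower (Ideal.span (Set.range y)) 1 = Ideal.span (Set.range y) := by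
        simp [bracketPower]
      rw [this]
      refine Ideal.span_le.2 ?_
      rintro _ ⟨k, rfl⟩
      dsimp only [y]
      split_ifs with h
      · exact Ideal.mem_sup_left (Ideal.subset_span ⟨k, h, rfl⟩)
      · exact Ideal.mem_sup_right (Ideal.pow_mem_pow (hx.mem_maximalIdeal k) N)
    exact hle2 h1
  have hinf := Ideal.iInf_pow_smul_eq_bot_of_isLocalRing (M := R ⧸ powerIdeal x n Λ)
    (IsLocalRing.maximalIdeal R) (IsLocalRing.maximalIdeal.isMaximal R).ne_top
  rw [← Ideal.Quotient.eq_zero_iff_mem]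
  refine (Submodule.mem_bot R).1 (hinf ▸ (Submodule.mem_iInf _).2 fun N => ?_)
  have h1 : c * z ∈ powerIdeal x n Λ ⊔ IsLocalRing.maximalIdeal R ^ N := by
    rcases Nat.eq_zero_or_pos N with rfl | hN
    · simp
    · exact hpow N hN
  rw [← map_smul_top_of_surjective (g := (powerIdeal x n Λ).mkQ) _ (Submodule.mkQ_surjective _),
    smul_eq_mul, Ideal.mul_top]
  rw [← Submodule.comap_map_mkQ] at h1
  exact h1

theorem IsTestFamily.comp {ι κ : Type*} {x : ι → R} (h : IsTestFamily p x) {g : κ → ι}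
    (hg : Function.Injective g) : IsTestFamily p (x ∘ g) := by
  -- Outside the range of g the exponent is irrelevant; the value 1 only keeps it positive.
  have key (n : κ → ℕ) (Λ : Set κ) : powerIdeal (x ∘ g) n Λ =
      powerIdeal x (Function.extend g n fun _ => 1) (g '' Λ) := by
    rw [powerIdeal, powerIdeal, Set.image_image]
    simp only [hg.extend_apply]
    rfl
  have hpos (n : κ → ℕ) (hn : ∀ k, 0 < n k) (i) : 0 < Function.extend g n (fun _ => 1) i := by
    by_cases hi : ∃ k, g k = i
    · obtain ⟨k, rfl⟩ := hi
      rw [hg.extend_apply]; exact hn k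
    · rw [Function.extend_apply' _ _ _ hi]; exact one_pos
  refine ⟨fun j => h.mem_compl _, fun Λ n j hn hj z hz => ?_, fun Λ n j hn z hz => ?_⟩
  · rw [key] at hz ⊢
    refine h.colon _ _ (g j) (hpos n hn) (by rwa [hg.mem_set_image]) z ?_
    rwa [hg.extend_apply]
  · rw [key] at hz ⊢
    exact h.mul_mem _ _ (g j) (hpos n hn) z hz

end CharP

/-! ### Manipulating one exponent at a time -/

section PowerIdeal

variable {R : Type*} [CommRing R] {ι : Type*} {x : ι → R}

theorem powerIdeal_congr {n n' : ι → ℕ} {Λ : Set ι} (h : ∀ k ∈ Λ, n k = n' k) :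
    powerIdeal x n Λ = powerIdeal x n' Λ := by
  unfold powerIdeal
  congr 1
  exact Set.image_congr fun k hk => by rw [h k hk]

theorem powerIdeal_mono {n : ι → ℕ} {Λ Λ' : Set ι} (h : Λ ⊆ Λ') :
    powerIdeal x n Λ ≤ powerIdeal x n Λ' :=
  Ideal.span_mono (Set.image_mono h)

theorem pow_mem_powerIdeal {n : ι → ℕ} {Λ : Set ι} {k : ι} (h : k ∈ Λ) :
    x k ^ n k ∈ powerIdeal x n Λ :=
  Ideal.subset_span ⟨k, h, rfl⟩

theorem mem_powerIdeal_insert {n : ι → ℕ} {Λ : Set ι} {j : ι} {w : R} :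
    w ∈ powerIdeal x n (insert j Λ) ↔ ∃ r, ∃ b ∈ powerIdeal x n Λ, w = r * x j ^ n j + b := by
  rw [powerIdeal, Set.image_insert_eq, Ideal.mem_span_insert]
  rfl

theorem powerIdeal_update_one_le [DecidableEq ι] (n : ι → ℕ) (hn : ∀ k, 0 < n k) (Λ : Set ι)
    (j : ι) : powerIdeal x n Λ ≤ powerIdeal x (Function.update n j 1) Λ := by
  refine Ideal.span_le.2 ?_
  rintro _ ⟨k, hk, rfl⟩
  have h := pow_mem_powerIdeal (x := x) (n := Function.update n j 1) hk
  rcases eq_or_ne k j with rfl | hkj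
  · rw [Function.update_self] at h
    exact Ideal.mem_of_dvd _ (pow_dvd_pow _ (hn k)) h
  · rwa [Function.update_of_ne hkj] at h

end PowerIdeal

namespace IsTestFamily

variable {p : ℕ} [Fact p.Prime] {R : Type*} [CommRing R] [CharP R p] {ι : Type*} {x : ι → R}

theorem colon_pow (h : IsTestFamily p x) {Λ : Set ι} {n : ι → ℕ} {j : ι}
    (hn : ∀ k, 0 < n k) (hj : j ∉ Λ) {a : ℕ} (ha : 0 < a) {z : R}
    (hz : x j ^ a * z ∈ powerIdeal x n Λ) : z ∈ tightClosure p (powerIdeal x n Λ) := by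
  classical
  have e : powerIdeal x n Λ = powerIdeal x (Function.update n j a) Λ :=
    powerIdeal_congr fun k hk => by
      rw [Function.update_of_ne]
      rintro rfl
      exact hj hk
  rw [e] at hz ⊢
  refine h.colon Λ _ j (fun k => ?_) hj z (by rwa [Function.update_self])
  rcases eq_or_ne k j with rfl | hkj
  · rwa [Function.update_self]
  · rw [Function.update_of_ne hkj]; exact hn k

theorem mem_of_pow_mul_mem (h : IsTestFamily p x) {Λ : Set ι} {n : ι → ℕ} {j : ι}
    (hn : ∀ k, 0 < n k) (hj : j ∉ Λ) {b : ℕ} {u : R}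
    (hu : x j ^ b * u ∈ tightClosure p (powerIdeal x n Λ)) :
    u ∈ tightClosure p (powerIdeal x n Λ) := by
  rcases Nat.eq_zero_or_pos b with rfl | hb
  · simpa using hu
  obtain ⟨c, hc, e₀, hz⟩ := hu
  have hp (e : ℕ) : 0 < p ^ e := pow_pos (Fact.out : p.Prime).pos _
  refine ⟨x j * c, mul_mem_minimalPrimesCompl (h.mem_compl j) hc, e₀, fun e he => ?_⟩
  have h1 := hz e he
  rw [bracketPower_powerIdeal] at h1 ⊢
  rw [mul_pow, ← pow_mul, mul_left_comm] at h1
  rw [mul_assoc]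
  have hn' (k) : 0 < n k * p ^ e := Nat.mul_pos (hn k) (hp e)
  exact h.mul_mem _ _ _ hn' _ (h.colon_pow hn' hj (Nat.mul_pos hb (hp e)) h1)

theorem mem_update_of_pow_mul_mem [DecidableEq ι] (h : IsTestFamily p x) {Λ : Set ι} {n : ι → ℕ}
    {j : ι} (hn : ∀ k, 0 < n k) (hj : j ∉ Λ) {a : R}
    (ha : x j ^ (n j - 1) * a ∈ tightClosure p (powerIdeal x n (insert j Λ))) :
    a ∈ tightClosure p (powerIdeal x (Function.update n j 1) (insert j Λ)) := by
  rcases (Nat.one_le_iff_ne_zero.2 (hn j).ne').eq_or_lt with h1 | h1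
  · rw [← h1] at ha
    rw [show Function.update n j 1 = n by rw [h1]; exact Function.update_eq_self j n]
    simpa using ha
  obtain ⟨c, hc, e₀, hz⟩ := ha
  have hp (e : ℕ) : 0 < p ^ e := pow_pos (Fact.out : p.Prime).pos _
  refine ⟨x j * c, mul_mem_minimalPrimesCompl (h.mem_compl j) hc, e₀, fun e he => ?_⟩
  have h2 := hz e he
  rw [bracketPower_powerIdeal] at h2 ⊢
  obtain ⟨r, b, hb, hrb⟩ := mem_powerIdeal_insert.1 h2
  have hn' (k) : 0 < n k * p ^ e := Nat.mul_pos (hn k) (hp e)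
  have e1 : x j ^ (n j * p ^ e) = x j ^ ((n j - 1) * p ^ e) * x j ^ p ^ e := by
    rw [← pow_add, ← Nat.succ_mul, Nat.succ_eq_add_one, Nat.sub_add_cancel h1.le]
  have h3 : x j ^ ((n j - 1) * p ^ e) * (c * a ^ p ^ e - r * x j ^ p ^ e) ∈
      powerIdeal x (fun k => n k * p ^ e) Λ := by
    have : x j ^ ((n j - 1) * p ^ e) * (c * a ^ p ^ e - r * x j ^ p ^ e) = b := by
      rw [e1, mul_pow, ← pow_mul] at hrb
      linear_combination hrb
    rwa [this]
  have h4 := h.mul_mem _ _ j hn' _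
    (h.colon_pow hn' hj (Nat.mul_pos (Nat.sub_pos_of_lt h1) (hp e)) h3)
  refine mem_powerIdeal_insert.2 ⟨x j * r, _, ?_, (sub_add_cancel _ _).symm.trans (add_comm _ _)⟩
  rw [Function.update_self, one_mul]
  have e2 : powerIdeal x (fun k => Function.update n j 1 k * p ^ e) Λ =
      powerIdeal x (fun k => n k * p ^ e) Λ := powerIdeal_congr fun k hk => by
    rw [Function.update_of_ne]
    rintro rfl
    exact hj hk
  rw [e2]
  have e3 : x j * c * a ^ p ^ e - x j * r * x j ^ p ^ e =
      x j * (c * a ^ p ^ e - r * x j ^ p ^ e) := by ring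
  rwa [e3]

theorem exists_eq_pow_mul_add [DecidableEq ι] (h : IsTestFamily p x) {Λ : Set ι} {n : ι → ℕ}
    {j : ι} (hn : ∀ k, 0 < n k) (hj : j ∉ Λ) {w : R}
    (hw : w ∈ tightClosure p (powerIdeal x n (insert j Λ))) :
    ∃ a ∈ tightClosure p (powerIdeal x (Function.update n j 1) (insert j Λ)),
      ∃ v ∈ tightClosure p (powerIdeal x n Λ), w = x j ^ (n j - 1) * a + v := by
  obtain ⟨r, b, hb, hrb⟩ := mem_powerIdeal_insert.1 (h.mul_mem _ _ j hn _ hw)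
  have hv : w - x j ^ (n j - 1) * r ∈ tightClosure p (powerIdeal x n Λ) := by
    refine h.colon_pow hn hj one_pos ?_
    have e : x j ^ n j = x j ^ (n j - 1) * x j := by
      rw [← pow_succ, Nat.sub_add_cancel (hn j)]
    have : x j ^ 1 * (w - x j ^ (n j - 1) * r) = b := by
      rw [e] at hrb
      linear_combination hrb
    rwa [this]
  refine ⟨r, h.mem_update_of_pow_mul_mem hn hj ?_, _, hv, by ring⟩
  rw [← sub_sub_cancel w (x j ^ (n j - 1) * r)]
  exact sub_mem hw (tightClosure_mono (powerIdeal_mono (Set.subset_insert _ _)) hv)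

end IsTestFamily

/-- The germ closure of the powers `x_k ^ n_k`, plus the ideal they generate. -/
noncomputable def germSum (p : ℕ) [Fact p.Prime] {R : Type*} [CommRing R] [CharP R p] {ι : Type*}
    (x : ι → R) (n : ι → ℕ) : Ideal R :=
  (⨆ j : ι, tightClosure p (powerIdeal x n {k | k ≠ j})) ⊔ powerIdeal x n Set.univ

section GermSum

variable {p : ℕ} [Fact p.Prime] {R : Type*} [CommRing R] [CharP R p] {ι : Type*} {x : ι → R}

theorem tightClosure_le_germSum (n : ι → ℕ) (j : ι) :
    tightClosure p (powerIdeal x n {k | k ≠ j}) ≤ germSum p x n :=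
  (le_iSup (fun j => tightClosure p (powerIdeal x n {k | k ≠ j})) j).trans le_sup_left

theorem IsTestFamily.mem_germSum_update [DecidableEq ι] (h : IsTestFamily p x) {n : ι → ℕ}
    (hn : ∀ k, 0 < n k) (k : ι) {y : R} (hy : x k ^ (n k - 1) * y ∈ germSum p x n) :
    y ∈ germSum p x (Function.update n k 1) := by
  have hle : germSum p x n ≤ Ideal.span {x k ^ (n k - 1)} * germSum p x (Function.update n k 1) ⊔
      tightClosure p (powerIdeal x n {l | l ≠ k}) := by
    refine sup_le (iSup_le fun j => ?_) ?_
    · rcases eq_or_ne j k with rfl | hjk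
      · exact le_sup_right
      · intro w hw
        have e : {l | l ≠ j} = insert k {l | l ≠ j ∧ l ≠ k} := by
          ext l
          simp only [Set.mem_ofPred_eq, Set.mem_insert_iff]
          constructor
          · intro hl
            by_cases hlk : l = k
            exacts [Or.inl hlk, Or.inr ⟨hl, hlk⟩]
          · rintro (rfl | hl)
            exacts [hjk.symm, hl.1]
        rw [e] at hw
        obtain ⟨a, ha, v, hv, rfl⟩ := h.exists_eq_pow_mul_add hn (fun hk => hk.2 rfl) hw
        rw [← e] at ha
        refine add_mem (Ideal.mem_sup_left (Ideal.mul_mem_mul (Ideal.mem_span_singleton_self _)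
          (tightClosure_le_germSum _ j ha))) (Ideal.mem_sup_right
          (tightClosure_mono (powerIdeal_mono fun l hl => hl.2) hv))
    · refine Ideal.span_le.2 ?_
      rintro _ ⟨l, -, rfl⟩
      rcases eq_or_ne l k with rfl | hlk
      · refine Ideal.mem_sup_left ?_
        have h1 := pow_mem_powerIdeal (x := x) (n := Function.update n l 1) (Set.mem_univ l)
        rw [Function.update_self, pow_one] at h1
        have h2 := Ideal.mul_mem_mul (Ideal.mem_span_singleton_self (x l ^ (n l - 1)))
          ((le_sup_right : _ ≤ germSum p x (Function.update n l 1)) h1)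
        rwa [← pow_succ, Nat.sub_add_cancel (hn l)] at h2
      · exact Ideal.mem_sup_right (le_tightClosure _ (pow_mem_powerIdeal hlk))
  obtain ⟨w, hw, v, hv, hwv⟩ := Submodule.mem_sup.1 (hle hy)
  obtain ⟨a, ha, rfl⟩ := Ideal.mem_span_singleton_mul.1 hw
  have h1 : y - a ∈ tightClosure p (powerIdeal x n {l | l ≠ k}) := by
    refine h.mem_of_pow_mul_mem (Λ := {l | l ≠ k}) (j := k) hn (fun hk => hk rfl)
      (b := n k - 1) ?_
    rwa [mul_sub, ← hwv, add_sub_cancel_left]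
  rw [← sub_add_cancel y a]
  exact add_mem (tightClosure_le_germSum _ k
    (tightClosure_mono (powerIdeal_update_one_le n hn _ k) h1)) ha

theorem IsTestFamily.mem_germSum_one [DecidableEq ι] (h : IsTestFamily p x) {s : ℕ} (hs : 0 < s)
    (Δ : Finset ι) {y : R}
    (hy : (∏ k ∈ Δ, x k) ^ (s - 1) * y ∈ germSum p x fun k => if k ∈ Δ then s else 1) :
    y ∈ germSum p x fun _ => 1 := by
  induction Δ using Finset.induction_on generalizing y with
  | empty => simpa using hy
  | insert k Δ hk ih =>
    apply ih
    have h1 := h.mem_germSum_update (n := fun l => if l ∈ insert k Δ then s else 1) (fun l => by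
      split_ifs
      exacts [hs, one_pos]) k (y := (∏ k ∈ Δ, x k) ^ (s - 1) * y) (by
      rw [if_pos (Finset.mem_insert_self _ _)]
      rwa [Finset.prod_insert hk, mul_pow, mul_assoc] at hy)
    convert h1 using 2
    ext l
    rcases eq_or_ne l k with rfl | hlk
    · rw [Function.update_self, if_neg hk]
    · rw [Function.update_of_ne hlk]
      simp [hlk]

variable {i : ℕ} {x : Fin i → R}

theorem germSum_one : germSum p x (fun _ => 1) = germClosure p x ⊔ Ideal.span (Set.range x) := by
  simp only [germSum, powerIdeal, pow_one, Set.image_univ, germClosure]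

theorem IsTestFamily.limitClosure_le (h : IsTestFamily p x) :
    limitClosure x ≤ germClosure p x ⊔ Ideal.span (Set.range x) := by
  rintro z ⟨s, hs, hz⟩
  rw [← germSum_one]
  refine h.mem_germSum_one hs Finset.univ ?_
  simp only [Finset.mem_univ, if_true]
  refine Ideal.mem_sup_right ?_
  rwa [powerIdeal, Set.image_univ]

theorem IsTestFamily.germClosure_le (h : IsTestFamily p x) : germClosure p x ≤ limitClosure x := by
  refine iSup_le fun j z hz => ⟨2, one_le_two, ?_⟩
  have h1 := h.mul_mem {k | k ≠ j} (fun _ => 1) j (fun _ => one_pos) z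
    (by simpa only [powerIdeal, pow_one] using hz)
  rw [pow_one, ← Finset.mul_prod_erase _ _ (Finset.mem_univ j), mul_comm (x j), mul_assoc]
  refine Submodule.span_induction (p := fun w _ => (∏ k ∈ Finset.univ.erase j, x k) * w ∈
    Ideal.span (Set.range fun k => x k ^ 2)) ?_ ?_ ?_ ?_ h1
  · rintro _ ⟨k, hk, rfl⟩
    obtain ⟨r, hr⟩ := Finset.dvd_prod_of_mem x (Finset.mem_erase.2 ⟨hk, Finset.mem_univ k⟩)
    have e : (∏ k ∈ Finset.univ.erase j, x k) * x k ^ 1 = r * x k ^ 2 := by rw [hr]; ring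
    dsimp only
    rw [e]
    exact Ideal.mul_mem_left _ _ (Ideal.subset_span ⟨k, rfl⟩)
  · simp
  · intro a b _ _ ha hb
    rw [mul_add]
    exact add_mem ha hb
  · intro r a _ ha
    rw [smul_eq_mul, mul_left_comm]
    exact Ideal.mul_mem_left _ _ ha

theorem span_range_le_limitClosure (x : Fin i → R) : Ideal.span (Set.range x) ≤ limitClosure x :=
  fun z hz => ⟨1, le_rfl, by simpa using hz⟩

theorem span_range_le_germClosure (x : Fin i → R) (hi : i ≠ 1) :
    Ideal.span (Set.range x) ≤ germClosure p x := by
  refine Ideal.span_le.2 ?_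
  rintro _ ⟨k, rfl⟩
  have : Nontrivial (Fin i) := Fin.nontrivial_iff_two_le.2 (by have := k.2; omega)
  obtain ⟨j, hj⟩ := exists_ne k
  exact (le_iSup (fun j => tightClosure p (Ideal.span (x '' {k | k ≠ j}))) j)
    (le_tightClosure _ (Ideal.subset_span ⟨k, hj.symm, rfl⟩))

end GermSum

end TightClosure

theorem mainTheorem9
    {p : ℕ} [Fact p.Prime]
    {R : Type*} [CommRing R] [IsLocalRing R] [IsNoetherianRing R] [CharP R p]
    (hR : TightClosure.IsEquidimensional R)
    {S : Type*} [CommRing S] (hS : TightClosure.IsCohenMacaulayRing S)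
    (f : S →+* R) (hf : Function.Surjective f)
    {d : ℕ} (x : Fin d → R) (hx : TightClosure.IsSystemOfParameters x)
    (hxt : ∀ j, TightClosure.IsParameterTestElement p (x j))
    (i : ℕ) (hi : i ≤ d) :
    TightClosure.germClosure p (fun j : Fin i => x (Fin.castLE hi j)) ⊔
          Ideal.span (Set.range fun j : Fin i => x (Fin.castLE hi j)) =
        TightClosure.limitClosure (fun j : Fin i => x (Fin.castLE hi j)) ∧
      (i ≠ 1 →
        TightClosure.germClosure p (fun j : Fin i => x (Fin.castLE hi j)) =
          TightClosure.limitClosure (fun j : Fin i => x (Fin.castLE hi j))) := by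
  obtain ⟨c, hc, hcolon⟩ := TightClosure.exists_uniform_colon hR hS f hf x hx
  have hfam : TightClosure.IsTestFamily p x :=
    ⟨fun j => (hxt j).1, TightClosure.mem_tightClosure_of_uniform_colon hc hcolon,
      fun Λ n j hn z hz =>
        TightClosure.mul_mem_of_isParameterTestElement hx (hxt j) Λ n hn z hz⟩
  have h : TightClosure.IsTestFamily p (fun j : Fin i => x (Fin.castLE hi j)) :=
    hfam.comp (Fin.castLE_injective hi)
  have hmain := le_antisymm
    (sup_le h.germClosure_le (TightClosure.span_range_le_limitClosure _)) h.limitClosure_le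
  refine ⟨hmain, fun hi1 => ?_⟩
  rw [← hmain, sup_eq_left.2 (TightClosure.span_range_le_germClosure _ hi1)]
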